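/- Let $r\ge 2$ be an integer, let $\mathbb T=\mathbb R/\mathbb Z$, let $R:\mathbb T\to\mathbb T$ be the map $R(t)=rt$, and let $\log=\log_2$. For an $R$-invariant Borel probability measure $\mu$ on $\mathbb T$ let $h(\mu)=\sup_{\mathcal P}\lim_{n\to\infty}\frac1n H_\mu\big(\bigvee_{i=0}^{n-1}R^{-i}\mathcal P\big)$ be its Kolmogorov–Sinai entropy, where $\mathcal P$ ranges over the finite measurable partitions of $\mathbb T$ and $H_\mu(\mathcal P)=-\sum_{A\in\mathcal P}\mu(A)\log\mu(A)$, and let $h_{\mathsf{top}}(\mathbb T,R)$ be the supremum of $h(\mu)$ over all such $\mu$. For $x\in\mathbb T$ let $\mathcal M_x$ be the set of all weak* limits of the measures $\frac1{n_k}\sum_{i=0}^{n_k-1}\delta_{R^ix}$ along increasing sequences $(n_k)$ (these limits are $R$-invariant), and put $$\underline h(x)=\inf\{h(\mu):\mu\in\mathcal M_x\},\qquad \overline h(x)=\sup\{h(\mu):\mu\in\mathcal M_x\}.$$ Then $h_{\mathsf{top}}(\mathbb T,R)=\log r$, and for all $x,y\in\mathbb T$ $$\max\{0,\ \underline h(x)-\overline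 h(y),\ \underline h(y)-\overline h(x)\}\le\underline h(x+y)\le\min\{\log r,\ \underline h(x)+\overline h(y),\ \overline h(x)+\underline h(y)\},$$ $$\max\{|\underline h(x)-\underline h(y)|,\ |\overline h(x)-\overline h(y)|\}\le\overline h(x+y)\le\min\{\log r,\ \overline h(x)+\overline h(y)\}.$$ -/

import Mathlib

open Filter Topology MeasureTheory
open scoped NNReal ENNReal

namespace PointEntropy

noncomputable section

section Measurable

variable {X : Type*} [MeasurableSpace X]

/-- Shannon entropy (logarithm in base `2`) of the partition of `X` into the cells `P ⁻¹' {a}`,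
`a : ι`. A finite partition is encoded by its labelling map `P : X → ι`; empty cells
contribute `0`. -/
def shannonEntropy {ι : Type*} [Fintype ι] (μ : Measure X) (P : X → ι) : ℝ :=
  -∑ a, μ.real (P ⁻¹' {a}) * Real.logb 2 (μ.real (P ⁻¹' {a}))

/-- The refined partition `⋁_{i < n} T^{-i} P`: its cell with label `a` is
`⋂_{i < n} T^{-i} (P ⁻¹' {a i})`. -/
def iteratedPartition {ι : Type*} (T : X → X) (P : X → ι) (n : ℕ) : X → (Fin n → ι) :=
  fun x i => P (T^[i] x)

/-- The dynamical entropy `lim_n (1/n) H_μ(P^n)` of the partition `P`. For an invariant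
probability measure and a measurable `P` the limit exists, so that it is equal to the upper
limit written here. -/
def partitionEntropy {ι : Type*} [Fintype ι] (T : X → X) (μ : Measure X) (P : X → ι) : EReal :=
  limsup (fun n : ℕ => ((shannonEntropy μ (iteratedPartition T P n) / n : ℝ) : EReal)) atTop

/-- The Kolmogorov-Sinai entropy `h_μ(T)`: supremum over all finite measurable partitions. -/
def ksEntropy (T : X → X) (μ : Measure X) : EReal :=
  ⨆ (k : ℕ) (P : X → Fin k) (_ : Measurable P), partitionEntropy T μ P

end Measurable

section Topological

variable {X : Type*} [TopologicalSpace X] [MeasurableSpace X] [OpensMeasurableSpace X]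

/-- The topological entropy, as the supremum of the entropies of all invariant Borel
probability measures. -/
def topologicalEntropy (T : X → X) : EReal :=
  ⨆ (μ : ProbabilityMeasure X) (_ : MeasurePreserving T (μ : Measure X) (μ : Measure X)),
    ksEntropy T (μ : Measure X)

/-- The empirical measure `(1/n) ∑_{i < n} δ_{T^i x}` (a probability measure when `0 < n`). -/
def empiricalMeasure (T : X → X) (x : X) (n : ℕ) : FiniteMeasure X :=
  (n : ℝ≥0)⁻¹ • ∑ i ∈ Finset.range n, (diracProba (T^[i] x)).toFiniteMeasure

/-- The set `𝓜_x` of Borel probability measures quasi-generated by `x`: the weak-* limits of the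
empirical measures of `x` along increasing sequences of times. -/
def quasiGenerated (T : X → X) (x : X) : Set (ProbabilityMeasure X) :=
  {μ | ∃ J : ℕ → ℕ, StrictMono J ∧
    Tendsto (fun k => empiricalMeasure T x (J k)) atTop (𝓝 μ.toFiniteMeasure)}

/-- The lower entropy of the point `x`. -/
def lowerEntropy (T : X → X) (x : X) : EReal :=
  ⨅ μ ∈ quasiGenerated T x, ksEntropy T (μ : Measure X)

/-- The upper entropy of the point `x`. -/
def upperEntropy (T : X → X) (x : X) : EReal :=
  ⨆ μ ∈ quasiGenerated T x, ksEntropy T (μ : Measure X)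

end Topological

/-- The map `t ↦ r t` of the circle `ℝ / ℤ`. -/
def timesMap (r : ℕ) (t : UnitAddCircle) : UnitAddCircle := r • t

end

end PointEntropy

/-! Everything comes from a triangle inequality for entropies. Given a sequence of times,
compactness yields a subsequence along which the empirical measures of (x, y) under R × R converge
on the two-torus. Its images under the two projections and under addition are R-invariant measures
μ, ν, ξ generated by x, y, x + y along the same times (`exists_joint_limits`).

For real s, t, ⌊rⁿ(s + t)⌋ exceeds ⌊rⁿs⌋ + ⌊rⁿt⌋ by a carry 0 or 1. So the n-digit labels of any two
of x, y, x + y, together with one bit, determine the third. Shannon subadditivity bounds one n-digit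
entropy by the sum of the other two plus one bit. The r-adic partition is a generator
(`ksEntropy_eq_limsup_digits`), so dividing by n shows that each of h(μ), h(ν), h(ξ) is at most the
sum of the other two (`ksEntropy_map_le_add`).

Choosing which point's generating sequence to start from turns this into inequalities between lower
and upper entropies; the rest is rearrangement. The bound log r holds because there are rⁿ cells at
level n, and Lebesgue measure attains it. -/

namespace PointEntropy

/-! ### Shannon entropy of finite partitions. -/

section Shannon

variable {X : Type*} [MeasurableSpace X] {μ : Measure X}
  {ι : Type*} [Fintype ι] {κ : Type*} [Fintype κ]

theorem shannonEntropy_eq_sum_negMulLog (P : X → ι) :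
    shannonEntropy μ P = (∑ a, Real.negMulLog (μ.real (P ⁻¹' {a}))) / Real.log 2 := by
  rw [shannonEntropy, Finset.sum_div, ← Finset.sum_neg_distrib]
  refine Finset.sum_congr rfl fun a _ => ?_
  rw [Real.negMulLog, Real.logb]
  ring

/-- The pointwise Gibbs inequality. -/
theorem negMulLog_le_of_nonneg {p q : ℝ} (hp : 0 ≤ p) (hq : 0 ≤ q) (h : q = 0 → p = 0) :
    Real.negMulLog p ≤ p * -Real.log q + (q - p) := by
  rcases hp.eq_or_lt with rfl | hp
  · simpa using hq
  have hq : 0 < q := hq.lt_of_ne fun h0 => hp.ne' (h h0.symm)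
  have h1 := Real.log_le_sub_one_of_pos (div_pos hq hp)
  rw [Real.log_div hq.ne' hp.ne'] at h1
  have h2 := mul_le_mul_of_nonneg_left h1 hp.le
  have h3 : p * (q / p - 1) = q - p := by field_simp
  rw [Real.negMulLog]
  linarith

theorem shannonEntropy_nonneg [IsProbabilityMeasure μ] (P : X → ι) : 0 ≤ shannonEntropy μ P := by
  rw [shannonEntropy_eq_sum_negMulLog]
  exact div_nonneg (Finset.sum_nonneg fun a _ =>
    Real.negMulLog_nonneg measureReal_nonneg measureReal_le_one) (Real.log_nonneg (by norm_num))

theorem shannonEntropy_comp_measurePreserving {Y : Type*} [MeasurableSpace Y] {ν : Measure Y}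
    [MeasurableSpace ι] [MeasurableSingletonClass ι]
    {T : X → Y} (hT : MeasurePreserving T μ ν) {P : Y → ι} (hP : Measurable P) :
    shannonEntropy μ (fun x => P (T x)) = shannonEntropy ν P := by
  unfold shannonEntropy
  congr 1
  refine Finset.sum_congr rfl fun a _ => ?_
  rw [← hT.measureReal_preimage (hP (measurableSet_singleton a)).nullMeasurableSet]
  rfl

/-- Each cell of the coarse partition is a disjoint union of fine cells, each no larger than the
union, and -log is decreasing. -/
theorem shannonEntropy_comp_le [IsFiniteMeasure μ] [MeasurableSpace ι]
    [MeasurableSingletonClass ι] {P : X → ι} (hP : Measurable P) (g : ι → κ) :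
    shannonEntropy μ (fun x => g (P x)) ≤ shannonEntropy μ P := by
  classical
  rw [shannonEntropy_eq_sum_negMulLog, shannonEntropy_eq_sum_negMulLog]
  refine div_le_div_of_nonneg_right ?_ (Real.log_nonneg (by norm_num))
  rw [← Finset.sum_fiberwise Finset.univ g fun a => Real.negMulLog (μ.real (P ⁻¹' {a}))]
  refine Finset.sum_le_sum fun b _ => ?_
  have hb : μ.real ((fun x => g (P x)) ⁻¹' {b}) =
      ∑ a ∈ Finset.univ.filter (g · = b), μ.real (P ⁻¹' {a}) := by
    rw [sum_measureReal_preimage_singleton _ fun a _ => hP (measurableSet_singleton a)]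
    congr 1
    ext x
    simp
  rw [Real.negMulLog, neg_mul_comm, hb, Finset.sum_mul]
  refine Finset.sum_le_sum fun a ha => ?_
  have h0 : 0 ≤ μ.real (P ⁻¹' {a}) := measureReal_nonneg
  rw [Real.negMulLog, neg_mul_comm]
  rcases h0.eq_or_lt with h | h
  · simp [← h]
  refine mul_le_mul_of_nonneg_left (neg_le_neg (Real.log_le_log h ?_)) h0
  exact Finset.single_le_sum (f := fun a => μ.real (P ⁻¹' {a}))
    (fun _ _ => measureReal_nonneg) ha

/-- A coarser partition has smaller entropy. -/
theorem shannonEntropy_le_of_factorsThrough [IsFiniteMeasure μ] [MeasurableSpace ι]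
    [MeasurableSingletonClass ι] {P : X → ι} (hP : Measurable P) {Q : X → κ}
    (h : ∀ x y, P x = P y → Q x = Q y) :
    shannonEntropy μ Q ≤ shannonEntropy μ P := by
  rcases isEmpty_or_nonempty κ with hκ | hκ
  · have : IsEmpty X := ⟨fun x => hκ.elim (Q x)⟩
    have h0 : μ = 0 := Subsingleton.elim _ _
    subst h0
    simp [shannonEntropy]
  obtain ⟨g, rfl⟩ := (Function.factorsThrough_iff (f := P) Q).1 fun x y => h x y
  exact shannonEntropy_comp_le hP g

/-- Gibbs' inequality, comparing the joint law `c` with the product of its marginals `p` and `q`.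
The corrections `p a * q b - c a b` sum to zero. -/
theorem shannonEntropy_prodMk_le [IsProbabilityMeasure μ] [MeasurableSpace ι]
    [MeasurableSingletonClass ι] [MeasurableSpace κ] [MeasurableSingletonClass κ]
    {P : X → ι} (hP : Measurable P) {Q : X → κ} (hQ : Measurable Q) :
    shannonEntropy μ (fun x => (P x, Q x)) ≤ shannonEntropy μ P + shannonEntropy μ Q := by
  classical
  simp only [shannonEntropy_eq_sum_negMulLog]
  rw [← add_div]
  refine div_le_div_of_nonneg_right ?_ (Real.log_nonneg (by norm_num))
  set c : ι → κ → ℝ := fun a b => μ.real ((fun x => (P x, Q x)) ⁻¹' {(a, b)}) with hc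
  set p : ι → ℝ := fun a => μ.real (P ⁻¹' {a}) with hp
  set q : κ → ℝ := fun b => μ.real (Q ⁻¹' {b}) with hq
  have hPQ : Measurable fun x => (P x, Q x) := hP.prodMk hQ
  have hc0 : ∀ a b, 0 ≤ c a b := fun a b => measureReal_nonneg
  have hp0 : ∀ a, 0 ≤ p a := fun a => measureReal_nonneg
  have hq0 : ∀ b, 0 ≤ q b := fun b => measureReal_nonneg
  have hcp : ∀ a, ∑ b, c a b = p a := fun a => by
    have h := sum_measureReal_preimage_singleton (μ := μ)
      (Finset.univ.map ⟨fun b => (a, b), fun _ _ h => (Prod.ext_iff.1 h).2⟩)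
      fun z _ => hPQ (measurableSet_singleton z)
    rw [Finset.sum_map] at h
    refine h.trans ?_
    congr 1
    ext x
    simp only [Finset.coe_map, Set.mem_preimage, Set.mem_image, Set.mem_singleton_iff]
    exact ⟨fun ⟨_, _, h⟩ => (congrArg Prod.fst h).symm,
      fun h => ⟨Q x, by simp, Prod.ext h.symm rfl⟩⟩
  have hcq : ∀ b, ∑ a, c a b = q b := fun b => by
    have h := sum_measureReal_preimage_singleton (μ := μ)
      (Finset.univ.map ⟨fun a => (a, b), fun _ _ h => (Prod.ext_iff.1 h).1⟩)
      fun z _ => hPQ (measurableSet_singleton z)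
    rw [Finset.sum_map] at h
    refine h.trans ?_
    congr 1
    ext x
    simp only [Finset.coe_map, Set.mem_preimage, Set.mem_image, Set.mem_singleton_iff]
    exact ⟨fun ⟨_, _, h⟩ => (congrArg Prod.snd h).symm,
      fun h => ⟨P x, by simp, Prod.ext rfl h.symm⟩⟩
  have hp1 : ∑ a, p a = 1 := by
    rw [sum_measureReal_preimage_singleton _ fun z _ => hP (measurableSet_singleton z)]
    simp
  have hq1 : ∑ b, q b = 1 := by
    rw [sum_measureReal_preimage_singleton _ fun z _ => hQ (measurableSet_singleton z)]
    simp
  have key : ∀ a b, Real.negMulLog (c a b) ≤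
      c a b * -Real.log (p a) + c a b * -Real.log (q b) + (p a * q b - c a b) := fun a b => by
    have h1 : c a b ≤ p a :=
      hcp a ▸ Finset.single_le_sum (fun b _ => hc0 a b) (Finset.mem_univ b)
    have h2 : c a b ≤ q b :=
      hcq b ▸ Finset.single_le_sum (fun a _ => hc0 a b) (Finset.mem_univ a)
    rcases (hc0 a b).eq_or_lt with h | h
    · rw [← h]
      simpa using mul_nonneg (hp0 a) (hq0 b)
    have h3 := negMulLog_le_of_nonneg h.le (mul_nonneg (hp0 a) (hq0 b)) fun h0 =>
      absurd h0 (mul_pos (h.trans_le h1) (h.trans_le h2)).ne'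
    rw [Real.log_mul (h.trans_le h1).ne' (h.trans_le h2).ne'] at h3
    linarith
  rw [Fintype.sum_prod_type]
  calc ∑ a, ∑ b, Real.negMulLog (c a b)
      ≤ ∑ a, ∑ b, (c a b * -Real.log (p a) + c a b * -Real.log (q b) + (p a * q b - c a b)) :=
        Finset.sum_le_sum fun a _ => Finset.sum_le_sum fun b _ => key a b
    _ = ∑ a, (∑ b, c a b) * -Real.log (p a) + ∑ b, (∑ a, c a b) * -Real.log (q b) +
          ((∑ a, p a) * (∑ b, q b) - ∑ a, ∑ b, c a b) := by
        rw [Finset.sum_mul_sum]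
        simp only [Finset.sum_add_distrib, Finset.sum_sub_distrib, Finset.sum_mul]
        rw [Finset.sum_comm (f := fun b a => c a b * -Real.log (q b))]
    _ = ∑ a, Real.negMulLog (p a) + ∑ b, Real.negMulLog (q b) := by
        simp only [hcp, hcq, hp1, hq1, Real.negMulLog]
        simp

/-- Gibbs' inequality against the uniform law. -/
theorem shannonEntropy_le_logb_card [IsProbabilityMeasure μ] [MeasurableSpace ι]
    [MeasurableSingletonClass ι] {P : X → ι} (hP : Measurable P) :
    shannonEntropy μ P ≤ Real.logb 2 (Fintype.card ι) := by
  rw [shannonEntropy_eq_sum_negMulLog, Real.logb]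
  refine div_le_div_of_nonneg_right ?_ (Real.log_nonneg (by norm_num))
  have hp1 : ∑ a, μ.real (P ⁻¹' {a}) = 1 := by
    rw [sum_measureReal_preimage_singleton _ fun z _ => hP (measurableSet_singleton z)]
    simp
  have hι : (Fintype.card ι : ℝ) ≠ 0 := by
    intro h
    have : IsEmpty ι := Fintype.card_eq_zero_iff.1 (by exact_mod_cast h)
    simp at hp1
  calc ∑ a, Real.negMulLog (μ.real (P ⁻¹' {a}))
      ≤ ∑ a, (μ.real (P ⁻¹' {a}) * -Real.log (Fintype.card ι : ℝ)⁻¹ +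
          ((Fintype.card ι : ℝ)⁻¹ - μ.real (P ⁻¹' {a}))) :=
        Finset.sum_le_sum fun a _ => negMulLog_le_of_nonneg measureReal_nonneg
          (by positivity) fun h => absurd h (inv_ne_zero hι)
    _ = Real.log (Fintype.card ι) := by
        rw [Finset.sum_add_distrib, Finset.sum_sub_distrib, ← Finset.sum_mul, hp1]
        simp [hι]

/-- A partition one of whose cells has almost full measure has small entropy. -/
theorem exists_shannonEntropy_le (κ : Type*) [Fintype κ] [MeasurableSpace κ]
    [MeasurableSingletonClass κ] (a₀ : κ) {ε : ℝ} (hε : 0 < ε) :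
    ∃ δ > 0, ∀ (μ : Measure X) [IsProbabilityMeasure μ] (P : X → κ), Measurable P →
      μ.real {x | P x ≠ a₀} < δ → shannonEntropy μ P ≤ ε := by
  have : Nonempty κ := ⟨a₀⟩
  -- An equal share of the entropy budget for each cell. Since `negMulLog` is continuous and
  -- vanishes at 0 and 1, both the large cell and the small ones stay within it.
  set η : ℝ := ε * Real.log 2 / Fintype.card κ with hη
  have hlog : 0 < Real.log 2 := Real.log_pos (by norm_num)
  have hη0 : 0 < η := by positivity
  obtain ⟨δ₀, hδ₀, h₀⟩ := Metric.continuous_iff.1 Real.continuous_negMulLog 0 η hη0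
  obtain ⟨δ₁, hδ₁, h₁⟩ := Metric.continuous_iff.1 Real.continuous_negMulLog 1 η hη0
  refine ⟨min δ₀ δ₁, lt_min hδ₀ hδ₁, fun μ _ P hP hμ => ?_⟩
  rw [shannonEntropy_eq_sum_negMulLog, div_le_iff₀ hlog]
  have hcell : ∀ a, Real.negMulLog (μ.real (P ⁻¹' {a})) ≤ η := fun a => by
    by_cases ha : a = a₀
    · subst ha
      have hcompl : {x | P x ≠ a} = (P ⁻¹' {a})ᶜ := rfl
      rw [hcompl, probReal_compl_eq_one_sub (hP (measurableSet_singleton a))] at hμ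
      have h2 : μ.real (P ⁻¹' {a}) ≤ 1 := measureReal_le_one
      have := h₁ (μ.real (P ⁻¹' {a})) (by
        rw [Real.dist_eq, abs_sub_comm, abs_of_nonneg (by linarith)]
        exact hμ.trans_le (min_le_right _ _))
      rw [Real.negMulLog_one, Real.dist_eq, sub_zero] at this
      exact (le_abs_self _).trans this.le
    · have h2 : μ.real (P ⁻¹' {a}) ≤ μ.real {x | P x ≠ a₀} :=
        measureReal_mono fun x hx => by
          rw [Set.mem_preimage, Set.mem_singleton_iff] at hx
          simpa [hx] using ha
      have := h₀ (μ.real (P ⁻¹' {a})) (by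
        rw [Real.dist_eq, sub_zero, abs_of_nonneg measureReal_nonneg]
        exact h2.trans_lt (hμ.trans_le (min_le_left _ _)))
      rw [Real.negMulLog_zero, Real.dist_eq, sub_zero] at this
      exact (le_abs_self _).trans this.le
  calc ∑ a, Real.negMulLog (μ.real (P ⁻¹' {a})) ≤ ∑ _a : κ, η :=
        Finset.sum_le_sum fun a _ => hcell a
    _ = ε * Real.log 2 := by
        rw [Finset.sum_const, Finset.card_univ, nsmul_eq_mul, hη]
        field_simp

theorem measurable_iteratedPartition {ι : Type*} [MeasurableSpace ι] {T : X → X} (hT : Measurable T)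
    {P : X → ι} (hP : Measurable P) (n : ℕ) : Measurable (iteratedPartition T P n) :=
  measurable_pi_lambda _ fun i => hP.comp (hT.iterate i)

theorem shannonEntropy_iteratedPartition_le [IsProbabilityMeasure μ] [MeasurableSpace ι]
    [MeasurableSingletonClass ι] {T : X → X} (hT : MeasurePreserving T μ μ)
    {P : X → ι} (hP : Measurable P) (n : ℕ) :
    shannonEntropy μ (iteratedPartition T P n) ≤ n * shannonEntropy μ P := by
  induction n with
  | zero =>
    refine (shannonEntropy_le_logb_card
      (measurable_iteratedPartition hT.measurable hP 0)).trans ?_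
    simp
  | succ n ih =>
    have hP' : Measurable fun x => P (T^[n] x) := hP.comp (hT.measurable.iterate n)
    have hn := measurable_iteratedPartition hT.measurable hP n
    calc shannonEntropy μ (iteratedPartition T P (n + 1))
        ≤ shannonEntropy μ (fun x => (iteratedPartition T P n x, P (T^[n] x))) := by
          refine shannonEntropy_le_of_factorsThrough (hn.prodMk hP') fun x y hxy => ?_
          rw [Prod.mk.injEq] at hxy
          funext i
          refine Fin.lastCases hxy.2 (fun j => ?_) i
          exact congrFun hxy.1 j
      _ ≤ shannonEntropy μ (iteratedPartition T P n) + shannonEntropy μ (fun x => P (T^[n] x)) :=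
          shannonEntropy_prodMk_le hn hP'
      _ ≤ n * shannonEntropy μ P + shannonEntropy μ P := by
          rw [shannonEntropy_comp_measurePreserving (hT.iterate n) hP]
          linarith
      _ = (n + 1 : ℕ) * shannonEntropy μ P := by push_cast; ring

end Shannon

/-! ### Partitions of the circle by r-adic intervals. -/

section Digits

variable {r : ℕ}

/-- The label of the `r`-adic interval of length `r ^ (-n)` containing a point of the circle. -/
noncomputable def digits (r n : ℕ) : UnitAddCircle → ZMod (r ^ n) :=
  Function.Periodic.lift (f := fun t : ℝ => ((⌊(r : ℝ) ^ n * t⌋ : ℤ) : ZMod (r ^ n))) (c := 1)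
    fun t => by
      -- Labels live in `ZMod (r ^ n)` because a unit translation adds rⁿ to the floor; this also
      -- makes the labels additive up to a carry.
      have h : (r : ℝ) ^ n * (t + 1) = (r : ℝ) ^ n * t + ((r ^ n : ℕ) : ℝ) := by push_cast; ring
      simp only [h, Int.floor_add_natCast, Int.cast_add, Int.cast_natCast, ZMod.natCast_self,
        add_zero]

theorem digits_coe (n : ℕ) (t : ℝ) :
    digits r n (t : UnitAddCircle) = ((⌊(r : ℝ) ^ n * t⌋ : ℤ) : ZMod (r ^ n)) := rfl

theorem exists_coe_eq (x : UnitAddCircle) : ∃ t ∈ Set.Ico (0 : ℝ) 1, (t : UnitAddCircle) = x := by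
  refine ⟨AddCircle.equivIco 1 0 x, ?_, AddCircle.coe_equivIco⟩
  simpa using (AddCircle.equivIco 1 0 x).2

theorem measurable_digits (n : ℕ) : Measurable (digits r n) := by
  have h : digits r n = fun x => ((⌊(r : ℝ) ^ n *
      (AddCircle.measurableEquivIco 1 0 x : ℝ)⌋ : ℤ) : ZMod (r ^ n)) := by
    funext x
    conv_lhs => rw [← AddCircle.coe_equivIco (p := (1 : ℝ)) (a := 0) (y := x)]
    rfl
  rw [h]
  have h1 : Measurable fun x : UnitAddCircle => (AddCircle.measurableEquivIco 1 0 x : ℝ) :=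
    measurable_subtype_coe.comp (AddCircle.measurableEquivIco 1 0).measurable
  exact (Measurable.of_discrete (f := fun k : ℤ => (k : ZMod (r ^ n)))).comp
    (Int.measurable_floor.comp (h1.const_mul _))

theorem timesMap_iterate_coe (i : ℕ) (t : ℝ) :
    (timesMap r)^[i] (t : UnitAddCircle) = ((r ^ i * t : ℝ) : UnitAddCircle) := by
  induction i with
  | zero => simp
  | succ i ih =>
    rw [Function.iterate_succ_apply', ih, timesMap, ← AddCircle.coe_nsmul, nsmul_eq_mul]
    congr 1
    ring

theorem continuous_timesMap : Continuous (timesMap r) := continuous_const_smul r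

theorem measurable_timesMap : Measurable (timesMap r) := continuous_timesMap.measurable

theorem floor_mem_of_mem_Ico {n : ℕ} {s : ℝ} (hs : s ∈ Set.Ico (0 : ℝ) 1) (hr : 0 < r) :
    0 ≤ ⌊(r : ℝ) ^ n * s⌋ ∧ ⌊(r : ℝ) ^ n * s⌋ < (r ^ n : ℕ) := by
  have : (0 : ℝ) < (r : ℝ) ^ n := by positivity
  refine ⟨Int.floor_nonneg.2 (mul_nonneg this.le hs.1), Int.floor_lt.2 ?_⟩
  push_cast
  nlinarith [hs.2]

theorem digits_coe_eq_iff (hr : 0 < r) {n : ℕ} {s t : ℝ} (hs : s ∈ Set.Ico (0 : ℝ) 1)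
    (ht : t ∈ Set.Ico (0 : ℝ) 1) :
    digits r n (s : UnitAddCircle) = digits r n (t : UnitAddCircle) ↔
      ⌊(r : ℝ) ^ n * s⌋ = ⌊(r : ℝ) ^ n * t⌋ := by
  refine ⟨fun h => ?_, fun h => by rw [digits_coe, digits_coe, h]⟩
  rw [digits_coe, digits_coe, ZMod.intCast_eq_intCast_iff] at h
  obtain ⟨h1, h2⟩ := floor_mem_of_mem_Ico (n := n) hs hr
  obtain ⟨h3, h4⟩ := floor_mem_of_mem_Ico (n := n) ht hr
  rw [Int.ModEq, Int.emod_eq_of_lt h1 h2, Int.emod_eq_of_lt h3 h4] at h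
  exact h

/-- Applying Rⁿ drops the n leading digits, which on labels is reduction modulo r ^ m. -/
theorem digits_iterate_eq {n m : ℕ} {x y : UnitAddCircle}
    (h : digits r (m + n) x = digits r (m + n) y) :
    digits r m ((timesMap r)^[n] x) = digits r m ((timesMap r)^[n] y) := by
  have key : ∀ x, digits r m ((timesMap r)^[n] x) =
      ZMod.castHom (pow_dvd_pow r (Nat.le_add_right m n)) (ZMod (r ^ m))
        (digits r (m + n) x) := fun x => by
    obtain ⟨s, -, rfl⟩ := exists_coe_eq x
    rw [timesMap_iterate_coe, digits_coe, digits_coe, map_intCast, pow_add, mul_assoc]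
  rw [key, key, h]

/-- Leading digits are not given by reduction modulo r ^ m, so the floors themselves are compared: a
≤ rᵐu iff rᵏa ≤ ⌊rᵏ⁺ᵐu⌋. -/
theorem digits_eq_of_le (hr : 0 < r) {m n : ℕ} (hmn : m ≤ n) {x y : UnitAddCircle}
    (h : digits r n x = digits r n y) : digits r m x = digits r m y := by
  obtain ⟨k, rfl⟩ := Nat.exists_eq_add_of_le' hmn
  obtain ⟨s, hs, rfl⟩ := exists_coe_eq x
  obtain ⟨t, ht, rfl⟩ := exists_coe_eq y
  rw [digits_coe_eq_iff hr hs ht] at h ⊢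
  have hk : (0 : ℝ) < (r : ℝ) ^ k := by positivity
  have key : ∀ (a : ℤ) (u : ℝ), (a : ℝ) ≤ (r : ℝ) ^ m * u ↔
      ((r ^ k : ℕ) * a : ℤ) ≤ ⌊(r : ℝ) ^ (k + m) * u⌋ := fun a u => by
    rw [Int.le_floor, pow_add, mul_assoc]
    push_cast
    exact (mul_le_mul_iff_right₀ hk).symm
  refine le_antisymm (Int.le_floor.2 ?_) (Int.le_floor.2 ?_)
  · rw [key, ← h, ← key]
    exact Int.floor_le _
  · rw [key, h, ← key]
    exact Int.floor_le _

/-- The first m + n digits are the first n followed by the first m of the n-th iterate. -/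
theorem digits_add_eq (hr : 0 < r) {m n : ℕ} {x y : UnitAddCircle}
    (h : digits r n x = digits r n y)
    (h' : digits r m ((timesMap r)^[n] x) = digits r m ((timesMap r)^[n] y)) :
    digits r (m + n) x = digits r (m + n) y := by
  obtain ⟨s, hs, rfl⟩ := exists_coe_eq x
  obtain ⟨t, ht, rfl⟩ := exists_coe_eq y
  rw [digits_coe_eq_iff hr hs ht] at h ⊢
  have key : ∀ u : ℝ, ((r ^ n * u : ℝ) : UnitAddCircle) =
      (Int.fract ((r : ℝ) ^ n * u) : ℝ) := fun u => by
    rw [Int.fract, AddCircle.coe_sub]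
    rw [eq_comm, sub_eq_self, AddCircle.coe_eq_zero_iff]
    exact ⟨⌊(r : ℝ) ^ n * u⌋, by simp⟩
  rw [timesMap_iterate_coe, timesMap_iterate_coe, key, key, digits_coe_eq_iff hr
    ⟨Int.fract_nonneg _, Int.fract_lt_one _⟩ ⟨Int.fract_nonneg _, Int.fract_lt_one _⟩] at h'
  have key2 : ∀ u : ℝ, ⌊(r : ℝ) ^ (m + n) * u⌋ =
      ⌊(r : ℝ) ^ m * Int.fract ((r : ℝ) ^ n * u)⌋ + (r ^ m : ℕ) * ⌊(r : ℝ) ^ n * u⌋ := fun u => by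
    rw [← Int.floor_add_intCast]
    congr 1
    rw [Int.fract]
    push_cast
    ring
  rw [key2, key2, h', h]

theorem dist_lt_of_digits_eq (hr : 0 < r) {n : ℕ} {x y : UnitAddCircle}
    (h : digits r n x = digits r n y) : dist x y < ((r : ℝ) ^ n)⁻¹ := by
  obtain ⟨s, hs, rfl⟩ := exists_coe_eq x
  obtain ⟨t, ht, rfl⟩ := exists_coe_eq y
  rw [digits_coe_eq_iff hr hs ht] at h
  have hr' : (0 : ℝ) < (r : ℝ) ^ n := by positivity
  have h1 := Int.abs_sub_lt_one_of_floor_eq_floor h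
  rw [← mul_sub, abs_mul, abs_of_pos hr'] at h1
  rw [dist_eq_norm, ← AddCircle.coe_sub]
  refine QuotientAddGroup.norm_mk_le_norm.trans_lt ?_
  rw [Real.norm_eq_abs, inv_eq_one_div, lt_div_iff₀ hr']
  linarith

/-- The carry: the floor of a sum exceeds the sum of the floors by 0 or 1. -/
theorem digits_add (n : ℕ) (x y : UnitAddCircle) :
    digits r n (x + y) = digits r n x + digits r n y ∨
      digits r n (x + y) = digits r n x + digits r n y + 1 := by
  obtain ⟨s, -, rfl⟩ := exists_coe_eq x
  obtain ⟨t, -, rfl⟩ := exists_coe_eq y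
  rw [← AddCircle.coe_add, digits_coe, digits_coe, digits_coe, mul_add, ← Int.cast_add,
    ← Int.cast_one, ← Int.cast_add]
  have h1 := Int.le_floor_add ((r : ℝ) ^ n * s) ((r : ℝ) ^ n * t)
  have h2 := Int.le_floor_add_floor ((r : ℝ) ^ n * s) ((r : ℝ) ^ n * t)
  rcases h1.eq_or_lt with h | h
  · exact Or.inl (by rw [h])
  · exact Or.inr (by congr 1; omega)

theorem digits_add_inv_pow (hr : 0 < r) (n : ℕ) (x : UnitAddCircle) :
    digits r n (x + (((r : ℝ) ^ n)⁻¹ : ℝ)) = digits r n x + 1 := by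
  obtain ⟨s, -, rfl⟩ := exists_coe_eq x
  have hr' : (r : ℝ) ^ n ≠ 0 := by positivity
  rw [← AddCircle.coe_add, digits_coe, digits_coe, mul_add, mul_inv_cancel₀ hr', Int.floor_add_one]
  push_cast
  rfl

end Digits

/-! ### The r-adic partition computes the Kolmogorov–Sinai entropy. -/

section Generator

theorem limsup_coe_mem_Icc {u : ℕ → ℝ} {M : ℝ} (hu : ∀ n, u n ∈ Set.Icc 0 M) :
    limsup (fun n => ((u n : ℝ) : EReal)) atTop ∈ Set.Icc (0 : EReal) (M : EReal) := by
  constructor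
  · exact le_limsup_of_frequently_le
      (Frequently.of_forall fun n => EReal.coe_nonneg.2 (hu n).1) (by isBoundedDefault)
  · exact limsup_le_of_le (by isBoundedDefault)
      (Eventually.of_forall fun n => EReal.coe_le_coe_iff.2 (hu n).2)

/-- Boundedness of `u` makes its upper limit finite, which rules out ⊤ + ⊥ in `EReal`. -/
theorem limsup_add_coe_le {u v : ℕ → ℝ} {M : ℝ} (hu : ∀ n, u n ∈ Set.Icc 0 M) :
    limsup (fun n => ((u n + v n : ℝ) : EReal)) atTop ≤
      limsup (fun n => ((u n : ℝ) : EReal)) atTop +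
        limsup (fun n => ((v n : ℝ) : EReal)) atTop := by
  obtain ⟨h0, h1⟩ := limsup_coe_mem_Icc hu
  have hbot : limsup (fun n => ((u n : ℝ) : EReal)) atTop ≠ ⊥ :=
    (EReal.bot_lt_zero.trans_le h0).ne'
  have htop : limsup (fun n => ((u n : ℝ) : EReal)) atTop ≠ ⊤ :=
    (h1.trans_lt (EReal.coe_lt_top M)).ne
  have hadd : (fun n => ((u n + v n : ℝ) : EReal)) =
      (fun n => ((u n : ℝ) : EReal)) + fun n => ((v n : ℝ) : EReal) :=
    funext fun n => EReal.coe_add _ _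
  rw [hadd]
  exact EReal.limsup_add_le (Or.inl hbot) (Or.inl htop)

/-- Growth rates are subadditive, and bounded errors do not matter. -/
theorem limsup_div_le_add {a b c : ℕ → ℝ} {K M N : ℝ} (hb : ∀ n, b n / n ∈ Set.Icc 0 M)
    (hc : ∀ n, c n / n ∈ Set.Icc 0 N) (h : ∀ n, a n ≤ b n + c n + K) :
    limsup (fun n : ℕ => ((a n / n : ℝ) : EReal)) atTop ≤
      limsup (fun n : ℕ => ((b n / n : ℝ) : EReal)) atTop +
        limsup (fun n : ℕ => ((c n / n : ℝ) : EReal)) atTop := by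
  have hK : limsup (fun n : ℕ => ((K / n : ℝ) : EReal)) atTop = 0 :=
    (EReal.tendsto_coe.2 (tendsto_const_div_atTop_nhds_zero_nat K)).limsup_eq
  calc limsup (fun n : ℕ => ((a n / n : ℝ) : EReal)) atTop
      ≤ limsup (fun n : ℕ => ((b n / n + (c n / n + K / n) : ℝ) : EReal)) atTop := by
        refine limsup_le_limsup (Eventually.of_forall fun n => ?_)
          (by isBoundedDefault) (by isBoundedDefault)
        rw [EReal.coe_le_coe_iff, ← add_div, ← add_div, ← add_assoc]
        exact div_le_div_of_nonneg_right (h n) n.cast_nonneg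
    _ ≤ _ := limsup_add_coe_le hb
    _ ≤ _ := add_le_add le_rfl ((limsup_add_coe_le hc).trans (by rw [hK, add_zero]))

variable {r : ℕ} [NeZero r] {μ : Measure UnitAddCircle} [IsProbabilityMeasure μ]

theorem shannonEntropy_digits_le (n : ℕ) :
    shannonEntropy μ (digits r n) ≤ n * Real.logb 2 r := by
  refine (shannonEntropy_le_logb_card (measurable_digits n)).trans_eq ?_
  rw [ZMod.card, Nat.cast_pow, Real.logb_pow]

theorem logb_nonneg_of_neZero : 0 ≤ Real.logb 2 r :=
  Real.logb_nonneg (by norm_num) (by exact_mod_cast NeZero.pos r)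

theorem shannonEntropy_digits_div_mem_Icc (n : ℕ) :
    shannonEntropy μ (digits r n) / n ∈ Set.Icc 0 (Real.logb 2 r) := by
  refine ⟨div_nonneg (shannonEntropy_nonneg _) n.cast_nonneg, ?_⟩
  rcases n.eq_zero_or_pos with rfl | hn
  · simpa using logb_nonneg_of_neZero
  · rw [div_le_iff₀' (by exact_mod_cast hn)]
    exact shannonEntropy_digits_le n

theorem shannonEntropy_digits_add_le (hμ : MeasurePreserving (timesMap r) μ μ) (m n : ℕ) :
    shannonEntropy μ (digits r (m + n)) ≤
      shannonEntropy μ (digits r n) + m * Real.logb 2 r := by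
  have hn := measurable_digits (r := r) n
  have hm : Measurable fun x => digits r m ((timesMap r)^[n] x) :=
    (measurable_digits m).comp (hμ.measurable.iterate n)
  calc shannonEntropy μ (digits r (m + n))
      ≤ shannonEntropy μ (fun x => (digits r n x, digits r m ((timesMap r)^[n] x))) :=
        shannonEntropy_le_of_factorsThrough (hn.prodMk hm) fun x y hxy =>
          digits_add_eq (NeZero.pos r) (Prod.ext_iff.1 hxy).1 (Prod.ext_iff.1 hxy).2
    _ ≤ _ := shannonEntropy_prodMk_le hn hm
    _ ≤ _ := by
        rw [shannonEntropy_comp_measurePreserving (hμ.iterate n) (measurable_digits m)]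
        exact add_le_add le_rfl (shannonEntropy_digits_le m)

/-- The `r`-adic partitions generate the Borel sets: every finite measurable partition is
approximated by a function of finitely many digits. -/
theorem exists_digits_approx (hr : 2 ≤ r) {k : ℕ} {Q : UnitAddCircle → Fin k}
    (hQ : Measurable Q) {δ : ℝ} (hδ : 0 < δ) :
    ∃ (m : ℕ) (g : ZMod (r ^ m) → Fin k), μ.real {x | Q x ≠ g (digits r m x)} < δ := by
  classical
  have hk : 0 < k := (Q 0).pos
  have hε : ENNReal.ofReal (δ / k) ≠ 0 := by
    rw [Ne, ENNReal.ofReal_eq_zero, not_le]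
    positivity
  -- Inner regularity: closed sets filling the cells of `Q` up to δ / k each. They are disjoint and
  -- compact, hence at positive distance, so a short enough r-adic interval meets at most one of
  -- them.
  choose K hKQ hKc hKμ using fun a : Fin k =>
    (hQ (measurableSet_singleton a)).exists_isClosed_sdiff_lt (measure_ne_top μ _) hε
  have hsep : ∀ a b, a ≠ b → ∃ η : ℝ, 0 < η ∧ ∀ x ∈ K a, ∀ y ∈ K b, η ≤ dist x y := by
    intro a b hab
    have hd : Disjoint (K a) (K b) := by
      rw [Set.disjoint_left]
      intro x hxa hxb
      exact hab ((hKQ a hxa).symm.trans (hKQ b hxb))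
    obtain ⟨η, hη, h⟩ := hd.exists_thickenings (hKc a).isCompact (hKc b)
    refine ⟨η, hη, fun x hx y hy => ?_⟩
    by_contra! hlt
    exact Set.disjoint_left.1 h (Metric.mem_thickening_iff.2 ⟨x, hx, by rwa [dist_comm]⟩)
      (Metric.self_subset_thickening hη _ hy)
  choose! η hη0 hη using hsep
  have hpow : Tendsto (fun m : ℕ => ((r : ℝ) ^ m)⁻¹) atTop (𝓝 0) :=
    tendsto_inv_atTop_zero.comp
      (tendsto_pow_atTop_atTop_of_one_lt (by exact_mod_cast (by omega : 1 < r)))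
  have hev : ∀ᶠ m : ℕ in atTop, ∀ a b, a ≠ b → ((r : ℝ) ^ m)⁻¹ < η a b := by
    refine eventually_all.2 fun a => eventually_all.2 fun b => ?_
    by_cases hab : a = b
    · simp [hab]
    · filter_upwards [hpow.eventually_lt_const (hη0 a b hab)] with m hm _ using hm
  obtain ⟨m, hm⟩ := hev.exists
  -- An interval gets the label of the set `K a` it meets; the default `Q 0` only matters off these
  -- sets.
  let g : ZMod (r ^ m) → Fin k := fun c =>
    if h : ∃ a, ∃ x ∈ K a, digits r m x = c then h.choose else Q 0
  have hg : ∀ a, ∀ x ∈ K a, g (digits r m x) = a := by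
    intro a x hx
    have h : ∃ b, ∃ y ∈ K b, digits r m y = digits r m x := ⟨a, x, hx, rfl⟩
    obtain ⟨y, hy, hyx⟩ := h.choose_spec
    have hgx : g (digits r m x) = h.choose := dif_pos h
    rw [hgx]
    by_contra hne
    exact absurd (hη _ _ hne y hy x hx)
      (not_le.2 ((dist_lt_of_digits_eq (NeZero.pos r) hyx).trans (hm _ _ hne)))
  refine ⟨m, g, ?_⟩
  have hsub : {x | Q x ≠ g (digits r m x)} ⊆ ⋃ a, (Q ⁻¹' {a} \ K a) := by
    intro x hx
    refine Set.mem_iUnion.2 ⟨Q x, rfl, fun hxK => hx ?_⟩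
    exact (hg _ x hxK).symm
  have : Nonempty (Fin k) := ⟨Q 0⟩
  calc μ.real {x | Q x ≠ g (digits r m x)} ≤ μ.real (⋃ a, (Q ⁻¹' {a} \ K a)) :=
        measureReal_mono hsub
    _ ≤ ∑ a, μ.real (Q ⁻¹' {a} \ K a) := measureReal_iUnion_fintype_le _
    _ < ∑ _a : Fin k, δ / k := by
        refine Finset.sum_lt_sum_of_nonempty Finset.univ_nonempty fun a _ => ?_
        exact (ENNReal.lt_ofReal_iff_toReal_lt (measure_ne_top μ _)).1 (hKμ a)
    _ = δ := by
        rw [Finset.sum_const, Finset.card_univ, Fintype.card_fin, nsmul_eq_mul]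
        field_simp

/-- `Q` is recovered from m digits and an error partition `E` of entropy at most ε. Hence n steps of
`Q` cost at most the entropy of m + n digits plus nε; the m extra digits vanish in the limit, and ε
is arbitrary. -/
theorem partitionEntropy_le_limsup_digits (hr : 2 ≤ r) (hμ : MeasurePreserving (timesMap r) μ μ)
    {k : ℕ} {Q : UnitAddCircle → Fin k} (hQ : Measurable Q) :
    partitionEntropy (timesMap r) μ Q ≤
      limsup (fun n : ℕ => ((shannonEntropy μ (digits r n) / n : ℝ) : EReal)) atTop := by
  classical
  have hL := limsup_coe_mem_Icc fun n => shannonEntropy_digits_div_mem_Icc (r := r) (μ := μ) n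
  set L := limsup (fun n : ℕ => ((shannonEntropy μ (digits r n) / n : ℝ) : EReal)) atTop
  have hε : ∀ ε : ℝ, 0 < ε → partitionEntropy (timesMap r) μ Q ≤ L + (ε : EReal) := by
    intro ε hε
    obtain ⟨δ, hδ, hE⟩ :=
      exists_shannonEntropy_le (X := UnitAddCircle) (Fin (k + 1)) (0 : Fin (k + 1)) hε
    obtain ⟨m, g, hg⟩ := exists_digits_approx (μ := μ) hr hQ hδ
    have hgm : Measurable fun x => g (digits r m x) :=
      (Measurable.of_discrete (f := g)).comp (measurable_digits m)
    -- Label 0 means that the approximation is right; otherwise `E` records the true value of `Q`,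
    -- shifted by one.
    let E : UnitAddCircle → Fin (k + 1) :=
      fun x => if Q x = g (digits r m x) then 0 else (Q x).succ
    have hEm : Measurable E := by
      refine Measurable.ite (measurableSet_eq_fun hQ hgm) measurable_const ?_
      exact (Measurable.of_discrete (f := Fin.succ)).comp hQ
    have hEε : shannonEntropy μ E ≤ ε := by
      refine hE μ E hEm ((measureReal_mono fun x hx => ?_).trans_lt hg)
      intro h
      exact hx (if_pos h)
    have hlim : limsup (fun n : ℕ => ((n * ε / n : ℝ) : EReal)) atTop = (ε : EReal) := by
      refine Tendsto.limsup_eq (EReal.tendsto_coe.2 (tendsto_const_nhds.congr' ?_))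
      filter_upwards [eventually_gt_atTop 0] with n hn
      field_simp
    rw [← hlim]
    refine limsup_div_le_add (K := m * Real.logb 2 r) (N := ε)
      (fun n => shannonEntropy_digits_div_mem_Icc n) (fun n => ?_) fun n => ?_
    · refine ⟨by positivity, ?_⟩
      rcases n.eq_zero_or_pos with rfl | hn
      · simpa using hε.le
      · exact (mul_div_cancel_left₀ ε (by positivity)).le
    have hEn := measurable_iteratedPartition hμ.measurable hEm n
    have hd := measurable_digits (r := r) (m + n)
    calc shannonEntropy μ (iteratedPartition (timesMap r) Q n)
        ≤ shannonEntropy μ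
            (fun x => (digits r (m + n) x, iteratedPartition (timesMap r) E n x)) := by
          refine shannonEntropy_le_of_factorsThrough (hd.prodMk hEn) fun x y hxy => ?_
          obtain ⟨h1, h2⟩ := Prod.ext_iff.1 hxy
          funext i
          have h3 : E ((timesMap r)^[i] x) = E ((timesMap r)^[i] y) := congrFun h2 i
          have h4 : digits r m ((timesMap r)^[i] x) = digits r m ((timesMap r)^[i] y) :=
            digits_iterate_eq (digits_eq_of_le (NeZero.pos r) (by omega) h1)
          change Q ((timesMap r)^[i] x) = Q ((timesMap r)^[i] y)
          simp only [E] at h3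
          split_ifs at h3 with h5 h6 h6
          · rw [h5, h6, h4]
          · exact absurd h3.symm (Fin.succ_ne_zero _)
          · exact absurd h3 (Fin.succ_ne_zero _)
          · exact Fin.succ_injective _ h3
      _ ≤ _ := shannonEntropy_prodMk_le hd hEn
      _ ≤ (shannonEntropy μ (digits r n) + m * Real.logb 2 r) + n * ε :=
          add_le_add (shannonEntropy_digits_add_le hμ m n)
            ((shannonEntropy_iteratedPartition_le hμ hEm n).trans
              (mul_le_mul_of_nonneg_left hEε n.cast_nonneg))
      _ = _ := by ring
  have hbot : L ≠ ⊥ := (EReal.bot_lt_zero.trans_le hL.1).ne'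
  have htop : L ≠ ⊤ := (hL.2.trans_lt (EReal.coe_lt_top _)).ne
  obtain ⟨l, hl⟩ : ∃ l : ℝ, (l : EReal) = L := ⟨L.toReal, EReal.coe_toReal htop hbot⟩
  rw [← hl] at hε ⊢
  refine EReal.le_of_forall_lt_iff_le.1 fun z hz => ?_
  have := hε (z - l) (sub_pos.2 (EReal.coe_lt_coe_iff.1 hz))
  rwa [← EReal.coe_add, add_sub_cancel] at this

theorem digits_eq_of_iteratedPartition_eq {n : ℕ} {x y : UnitAddCircle}
    (h : ∀ i < n, digits r 1 ((timesMap r)^[i] x) = digits r 1 ((timesMap r)^[i] y)) :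
    digits r n x = digits r n y := by
  induction n with
  | zero =>
    have : Subsingleton (ZMod (r ^ 0)) := by
      rw [pow_zero]
      infer_instance
    exact Subsingleton.elim _ _
  | succ n ih =>
    rw [add_comm n 1]
    exact digits_add_eq (NeZero.pos r) (ih fun i hi => h i (by omega)) (h n (by omega))

theorem limsup_digits_le_ksEntropy :
    limsup (fun n : ℕ => ((shannonEntropy μ (digits r n) / n : ℝ) : EReal)) atTop ≤
      ksEntropy (timesMap r) μ := by
  let e := Fintype.equivFin (ZMod (r ^ 1))
  have hP : Measurable fun x => e (digits r 1 x) :=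
    (Measurable.of_discrete (f := e)).comp (measurable_digits 1)
  refine le_trans ?_ (le_iSup₂_of_le (Fintype.card (ZMod (r ^ 1))) (fun x => e (digits r 1 x))
    (le_iSup_of_le hP le_rfl))
  refine limsup_le_limsup (Eventually.of_forall fun n => ?_)
    (by isBoundedDefault) (by isBoundedDefault)
  refine EReal.coe_le_coe_iff.2 (div_le_div_of_nonneg_right ?_ n.cast_nonneg)
  refine shannonEntropy_le_of_factorsThrough
    (measurable_iteratedPartition measurable_timesMap hP n) fun x y hxy => ?_
  exact digits_eq_of_iteratedPartition_eq fun i hi => e.injective (congrFun hxy ⟨i, hi⟩)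

/-- The `r`-adic partition is a generator: it computes the Kolmogorov-Sinai entropy. -/
theorem ksEntropy_eq_limsup_digits (hr : 2 ≤ r) (hμ : MeasurePreserving (timesMap r) μ μ) :
    ksEntropy (timesMap r) μ =
      limsup (fun n : ℕ => ((shannonEntropy μ (digits r n) / n : ℝ) : EReal)) atTop :=
  le_antisymm (iSup₂_le fun _ _ => iSup_le fun hQ => partitionEntropy_le_limsup_digits hr hμ hQ)
    limsup_digits_le_ksEntropy

theorem ksEntropy_mem_Icc (hr : 2 ≤ r) (hμ : MeasurePreserving (timesMap r) μ μ) :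
    ksEntropy (timesMap r) μ ∈ Set.Icc 0 ((Real.logb 2 r : ℝ) : EReal) := by
  rw [ksEntropy_eq_limsup_digits hr hμ]
  exact limsup_coe_mem_Icc fun n => shannonEntropy_digits_div_mem_Icc n

end Generator

/-! ### Lebesgue measure and the topological entropy. -/

section Haar

variable {r : ℕ} [NeZero r]

/-- Rotation by r⁻ⁿ permutes the rⁿ cells cyclically, so an invariant measure gives them equal mass.
-/
theorem measureReal_digits_preimage {μ : Measure UnitAddCircle} [IsProbabilityMeasure μ]
    [μ.IsAddRightInvariant] (n : ℕ) (a : ZMod (r ^ n)) :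
    μ.real (digits r n ⁻¹' {a}) = ((r : ℝ) ^ n)⁻¹ := by
  have hm : ∀ a, MeasurableSet (digits r n ⁻¹' {a}) := fun a =>
    measurable_digits n (measurableSet_singleton a)
  have hstep : ∀ a, μ.real (digits r n ⁻¹' {a + 1}) = μ.real (digits r n ⁻¹' {a}) := fun a => by
    rw [← (measurePreserving_add_right μ (((r : ℝ) ^ n)⁻¹ : ℝ)).measureReal_preimage
      (hm _).nullMeasurableSet]
    congr 1
    ext x
    simp [digits_add_inv_pow (NeZero.pos r)]
  have hconst : ∀ a, μ.real (digits r n ⁻¹' {a}) = μ.real (digits r n ⁻¹' {0}) := fun a => by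
    have : ∀ k : ℕ, μ.real (digits r n ⁻¹' {(k : ZMod (r ^ n))}) =
        μ.real (digits r n ⁻¹' {0}) := fun k => by
      induction k with
      | zero => simp
      | succ k ih => rw [Nat.cast_succ, hstep, ih]
    simpa using this a.val
  have hsum : ∑ a, μ.real (digits r n ⁻¹' {a}) = 1 := by
    rw [sum_measureReal_preimage_singleton _ fun a _ => hm a]
    simp
  simp only [hconst, Finset.sum_const, Finset.card_univ, ZMod.card, nsmul_eq_mul] at hsum
  rw [hconst, eq_inv_of_mul_eq_one_right hsum]
  push_cast
  rfl

theorem shannonEntropy_digits_of_isAddRightInvariant {μ : Measure UnitAddCircle}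
    [IsProbabilityMeasure μ] [μ.IsAddRightInvariant] (n : ℕ) :
    shannonEntropy μ (digits r n) = n * Real.logb 2 r := by
  have hr : (r : ℝ) ^ n ≠ 0 := pow_ne_zero _ (NeZero.ne _)
  simp only [shannonEntropy, measureReal_digits_preimage, Finset.sum_const, Finset.card_univ,
    ZMod.card, nsmul_eq_mul, Real.logb_inv, Real.logb_pow]
  push_cast
  field_simp

theorem topologicalEntropy_timesMap (hr : 2 ≤ r) :
    topologicalEntropy (timesMap r) = ((Real.logb 2 r : ℝ) : EReal) := by
  refine le_antisymm (iSup₂_le fun μ hμ => (ksEntropy_mem_Icc hr hμ).2) ?_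
  have : IsProbabilityMeasure (volume : Measure UnitAddCircle) := ⟨by simp⟩
  have hvol : MeasurePreserving (timesMap r) (volume : Measure UnitAddCircle) volume :=
    (AddCircle.ergodic_nsmul (T := (1 : ℝ)) (by omega : 1 < r)).toMeasurePreserving
  refine le_trans (le_of_eq ?_) (le_iSup₂_of_le
    (⟨volume, this⟩ : ProbabilityMeasure UnitAddCircle) hvol
    (limsup_digits_le_ksEntropy (μ := (volume : Measure UnitAddCircle))))
  refine (Tendsto.limsup_eq (EReal.tendsto_coe.2 (tendsto_const_nhds.congr' ?_))).symm
  filter_upwards [eventually_gt_atTop 0] with n hn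
  change _ = shannonEntropy volume (digits r n) / n
  rw [shannonEntropy_digits_of_isAddRightInvariant]
  field_simp

end Haar

/-! ### Empirical measures and their limits. -/

section Empirical

variable {X : Type*} [MeasurableSpace X] {Y : Type*} [MeasurableSpace Y]

theorem toMeasure_empiricalMeasure (T : X → X) (x : X) (n : ℕ) :
    (empiricalMeasure T x n : Measure X) =
      (n : ℝ≥0)⁻¹ • ∑ i ∈ Finset.range n, Measure.dirac (T^[i] x) := by
  rw [empiricalMeasure, FiniteMeasure.toMeasure_smul, FiniteMeasure.toMeasure_sum]
  rfl

theorem empiricalMeasure_map {T : X → X} {S : Y → Y} {f : X → Y} (hf : Measurable f)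
    (h : Function.Semiconj f T S) (x : X) (n : ℕ) :
    (empiricalMeasure T x n).map f = empiricalMeasure S (f x) n := by
  apply Subtype.ext
  change (empiricalMeasure T x n : Measure X).map f = (empiricalMeasure S (f x) n : Measure Y)
  rw [toMeasure_empiricalMeasure, toMeasure_empiricalMeasure]
  ext A hA
  rw [Measure.map_apply hf hA]
  simp only [Measure.smul_apply, Measure.finsetSum_apply]
  congr 1
  refine Finset.sum_congr rfl fun i _ => ?_
  rw [Measure.dirac_apply' _ (hf hA), Measure.dirac_apply' _ hA, ← (h.iterate_right i).eq]
  rfl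

theorem isProbabilityMeasure_empiricalMeasure (T : X → X) (x : X) {n : ℕ} (hn : n ≠ 0) :
    IsProbabilityMeasure (empiricalMeasure T x n : Measure X) := by
  refine ⟨?_⟩
  rw [toMeasure_empiricalMeasure]
  simp only [Measure.smul_apply, Measure.finsetSum_apply, measure_univ, Finset.sum_const,
    Finset.card_range, nsmul_eq_mul, mul_one]
  rw [ENNReal.smul_def, smul_eq_mul, ENNReal.coe_inv (by exact_mod_cast hn), ENNReal.coe_natCast]
  exact ENNReal.inv_mul_cancel (by exact_mod_cast hn) (ENNReal.natCast_ne_top n)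

variable [TopologicalSpace X] [OpensMeasurableSpace X] [TopologicalSpace Y] [BorelSpace Y]

theorem integral_empiricalMeasure (T : X → X) (x : X) (n : ℕ) {f : X → ℝ} (hf : Continuous f) :
    ∫ y, f y ∂(empiricalMeasure T x n : Measure X) =
      (n : ℝ)⁻¹ * ∑ i ∈ Finset.range n, f (T^[i] x) := by
  have hsm : StronglyMeasurable f := hf.measurable.stronglyMeasurable
  rw [toMeasure_empiricalMeasure, integral_smul_nnreal_measure,
    integral_finsetSum_measure fun i _ => integrable_dirac' hsm (by simp)]
  simp only [integral_dirac' _ _ hsm, NNReal.smul_def, smul_eq_mul]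
  push_cast
  rfl

theorem tendsto_empiricalMeasure_map {T : X → X} {S : Y → Y} {f : X → Y} (hf : Continuous f)
    (h : Function.Semiconj f T S) {x : X} {J : ℕ → ℕ} {μ : ProbabilityMeasure X}
    (hμ : Tendsto (fun k => empiricalMeasure T x (J k)) atTop (𝓝 μ.toFiniteMeasure)) :
    Tendsto (fun k => empiricalMeasure S (f x) (J k)) atTop
      (𝓝 (μ.map hf.measurable.aemeasurable).toFiniteMeasure) := by
  simp only [← empiricalMeasure_map hf.measurable h]
  exact FiniteMeasure.tendsto_map_of_tendsto_of_continuous _ _ hμ hf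

/-- The empirical averages of f ∘ T and f differ by a telescoping sum, of size at most 2‖f‖ / n. -/
theorem measurePreserving_of_mem_quasiGenerated [BorelSpace X] [HasOuterApproxClosed X]
    {T : X → X} (hT : Continuous T) {x : X} {μ : ProbabilityMeasure X}
    (hμ : μ ∈ quasiGenerated T x) : MeasurePreserving T (μ : Measure X) (μ : Measure X) := by
  obtain ⟨J, hJ, hlim⟩ := hμ
  refine ⟨hT.measurable, ?_⟩
  have hprob : IsProbabilityMeasure ((μ : Measure X).map T) :=
    Measure.isProbabilityMeasure_map hT.measurable.aemeasurable
  refine ext_of_forall_integral_eq_of_IsFiniteMeasure fun f => ?_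
  rw [integral_map hT.measurable.aemeasurable f.continuous.aestronglyMeasurable]
  rw [FiniteMeasure.tendsto_iff_forall_integral_tendsto] at hlim
  have h1 := hlim f
  have h2 := hlim (f.compContinuous ⟨T, hT⟩)
  have h3 : Tendsto (fun k => ∫ y, f (T y) ∂(empiricalMeasure T x (J k) : Measure X) -
      ∫ y, f y ∂(empiricalMeasure T x (J k) : Measure X)) atTop (𝓝 0) := by
    have hJ' : Tendsto (fun k => 2 * ‖f‖ / (J k : ℝ)) atTop (𝓝 0) :=
      (tendsto_const_div_atTop_nhds_zero_nat _).comp hJ.tendsto_atTop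
    refine squeeze_zero_norm (fun k => ?_) hJ'
    rw [integral_empiricalMeasure T x _ (f := fun y => f (T y)) (f.continuous.comp hT),
      integral_empiricalMeasure T x _ f.continuous, ← mul_sub, ← Finset.sum_sub_distrib]
    have htel : ∑ i ∈ Finset.range (J k), (f (T (T^[i] x)) - f (T^[i] x)) =
        f (T^[J k] x) - f x := by
      simpa only [Function.iterate_succ_apply', Function.iterate_zero_apply] using
        Finset.sum_range_sub (fun i => f (T^[i] x)) (J k)
    rw [htel, norm_mul, norm_inv, RCLike.norm_natCast, inv_mul_eq_div]
    refine div_le_div_of_nonneg_right ?_ (J k).cast_nonneg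
    calc ‖f (T^[J k] x) - f x‖ ≤ ‖f (T^[J k] x)‖ + ‖f x‖ := norm_sub_le _ _
      _ ≤ 2 * ‖f‖ := by linarith [f.norm_coe_le_norm (T^[J k] x), f.norm_coe_le_norm x]
  exact sub_eq_zero.1 (tendsto_nhds_unique (h2.sub h1) h3)

theorem exists_tendsto_empiricalMeasure [SeqCompactSpace (ProbabilityMeasure X)] (T : X → X)
    (x : X) {J : ℕ → ℕ} (hJ : StrictMono J) :
    ∃ (φ : ℕ → ℕ) (μ : ProbabilityMeasure X), StrictMono φ ∧
      Tendsto (fun k => empiricalMeasure T x (J (φ k))) atTop (𝓝 μ.toFiniteMeasure) := by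
  -- `J 0` may be 0, where the empirical measure is zero; hence the index shift.
  have hpos : ∀ k, J (k + 1) ≠ 0 := fun k => (hJ.id_le (k + 1)).trans_lt' k.succ_pos |>.ne'
  obtain ⟨μ, φ, hφ, hlim⟩ := SeqCompactSpace.tendsto_subseq
    fun k => show ProbabilityMeasure X from
    (⟨empiricalMeasure T x (J (k + 1)), isProbabilityMeasure_empiricalMeasure T x (hpos k)⟩)
  refine ⟨fun k => φ k + 1, μ, fun a b hab => Nat.succ_lt_succ (hφ hab), ?_⟩
  exact (ProbabilityMeasure.tendsto_nhds_iff_toFiniteMeasure_tendsto_nhds _).1 hlim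

end Empirical

/-! ### Joinings on the two-torus and the entropy triangle inequality. -/

section Joining

variable {r : ℕ} {Ω : Type*} [MeasurableSpace Ω] {ρ : Measure Ω} [IsProbabilityMeasure ρ]

/-- If the digits of `f` are determined by those of `g` and `h` up to a carry, then the entropy of
the law of `f` is at most the sum of those of the laws of `g` and `h`. -/
theorem ksEntropy_map_le_add [NeZero r] (hr : 2 ≤ r) {f g h : Ω → UnitAddCircle} (hf : Measurable f)
    (hg : Measurable g) (hh : Measurable h)
    (hfi : MeasurePreserving (timesMap r) (ρ.map f) (ρ.map f))
    (hgi : MeasurePreserving (timesMap r) (ρ.map g) (ρ.map g))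
    (hhi : MeasurePreserving (timesMap r) (ρ.map h) (ρ.map h))
    (c : ℕ → Ω → Bool) (hc : ∀ n, Measurable (c n))
    (H : ∀ n x y, digits r n (g x) = digits r n (g y) → digits r n (h x) = digits r n (h y) →
      c n x = c n y → digits r n (f x) = digits r n (f y)) :
    ksEntropy (timesMap r) (ρ.map f) ≤
      ksEntropy (timesMap r) (ρ.map g) + ksEntropy (timesMap r) (ρ.map h) := by
  have := Measure.isProbabilityMeasure_map (μ := ρ) hf.aemeasurable
  have := Measure.isProbabilityMeasure_map (μ := ρ) hg.aemeasurable
  have := Measure.isProbabilityMeasure_map (μ := ρ) hh.aemeasurable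
  rw [ksEntropy_eq_limsup_digits hr hfi, ksEntropy_eq_limsup_digits hr hgi,
    ksEntropy_eq_limsup_digits hr hhi]
  -- The error `K` is the one bit needed for `c n`.
  refine limsup_div_le_add (K := Real.logb 2 (Fintype.card Bool))
    (fun n => shannonEntropy_digits_div_mem_Icc n)
    (fun n => shannonEntropy_digits_div_mem_Icc n) fun n => ?_
  have hd := measurable_digits (r := r) n
  rw [← shannonEntropy_comp_measurePreserving ⟨hf, rfl⟩ hd,
    ← shannonEntropy_comp_measurePreserving ⟨hg, rfl⟩ hd,
    ← shannonEntropy_comp_measurePreserving ⟨hh, rfl⟩ hd]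
  have hgh := (hd.comp hg).prodMk (hd.comp hh)
  calc shannonEntropy ρ (fun x => digits r n (f x))
      ≤ shannonEntropy ρ (fun x => ((digits r n (g x), digits r n (h x)), c n x)) := by
        refine shannonEntropy_le_of_factorsThrough (hgh.prodMk (hc n)) fun x y hxy => ?_
        simp only [Prod.mk.injEq] at hxy
        exact H n x y hxy.1.1 hxy.1.2 hxy.2
    _ ≤ _ := shannonEntropy_prodMk_le hgh (hc n)
    _ ≤ _ := add_le_add (shannonEntropy_prodMk_le (hd.comp hg) (hd.comp hh))
        (shannonEntropy_le_logb_card (hc n))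

/-- Whether adding two points produces a carry into the first `n` digits. -/
noncomputable def carry (r n : ℕ) (p : UnitAddCircle × UnitAddCircle) : Bool :=
  decide (digits r n (p.1 + p.2) ≠ digits r n p.1 + digits r n p.2)

theorem measurable_carry [NeZero r] (n : ℕ) : Measurable (carry r n) := by
  have h1 := (measurable_digits (r := r) n).comp (measurable_fst.add measurable_snd)
  have h2 := (measurable_digits (r := r) n).comp (measurable_fst : Measurable
    (Prod.fst : UnitAddCircle × UnitAddCircle → UnitAddCircle))
  have h3 := (measurable_digits (r := r) n).comp (measurable_snd : Measurable
    (Prod.snd : UnitAddCircle × UnitAddCircle → UnitAddCircle))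
  exact (Measurable.of_discrete
    (f := fun q : ZMod (r ^ n) × ZMod (r ^ n) × ZMod (r ^ n) => decide (q.1 ≠ q.2.1 + q.2.2))).comp
      (h1.prodMk (h2.prodMk h3))

theorem digits_add_eq_carry (r n : ℕ) (p : UnitAddCircle × UnitAddCircle) :
    digits r n (p.1 + p.2) = digits r n p.1 + digits r n p.2 + if carry r n p then 1 else 0 := by
  by_cases h : digits r n (p.1 + p.2) = digits r n p.1 + digits r n p.2
  · simp [carry, h]
  · simp [carry, (digits_add n p.1 p.2).resolve_left h]

/-- Along a common subsequence, `x`, `y` and `x + y` quasi-generate measures each of whose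
entropies is at most the sum of the other two. -/
theorem exists_joint_limits [NeZero r] (hr : 2 ≤ r) (x y : UnitAddCircle) {J : ℕ → ℕ}
    (hJ : StrictMono J) :
    ∃ (φ : ℕ → ℕ) (μ ν ξ : ProbabilityMeasure UnitAddCircle), StrictMono φ ∧
      Tendsto (fun k => empiricalMeasure (timesMap r) x (J (φ k))) atTop (𝓝 μ.toFiniteMeasure) ∧
      Tendsto (fun k => empiricalMeasure (timesMap r) y (J (φ k))) atTop (𝓝 ν.toFiniteMeasure) ∧
      Tendsto (fun k => empiricalMeasure (timesMap r) (x + y) (J (φ k))) atTop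
        (𝓝 ξ.toFiniteMeasure) ∧
      ksEntropy (timesMap r) (ξ : Measure UnitAddCircle) ≤
        ksEntropy (timesMap r) (μ : Measure UnitAddCircle) +
          ksEntropy (timesMap r) (ν : Measure UnitAddCircle) ∧
      ksEntropy (timesMap r) (μ : Measure UnitAddCircle) ≤
        ksEntropy (timesMap r) (ξ : Measure UnitAddCircle) +
          ksEntropy (timesMap r) (ν : Measure UnitAddCircle) ∧
      ksEntropy (timesMap r) (ν : Measure UnitAddCircle) ≤
        ksEntropy (timesMap r) (ξ : Measure UnitAddCircle) +
          ksEntropy (timesMap r) (μ : Measure UnitAddCircle) := by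
  obtain ⟨φ, ρ, hφ, hρ⟩ :=
    exists_tendsto_empiricalMeasure (Prod.map (timesMap r) (timesMap r)) (x, y) hJ
  have hfst : Continuous (Prod.fst : UnitAddCircle × UnitAddCircle → UnitAddCircle) :=
    continuous_fst
  have hsnd : Continuous (Prod.snd : UnitAddCircle × UnitAddCircle → UnitAddCircle) :=
    continuous_snd
  have hadd : Continuous fun p : UnitAddCircle × UnitAddCircle => p.1 + p.2 := hfst.add hsnd
  have h1 := tendsto_empiricalMeasure_map (S := timesMap r) hfst (fun _ => rfl) hρ
  have h2 := tendsto_empiricalMeasure_map (S := timesMap r) hsnd (fun _ => rfl) hρ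
  have h3 := tendsto_empiricalMeasure_map (S := timesMap r) hadd
    (fun p => (smul_add r p.1 p.2).symm) hρ
  have i1 := measurePreserving_of_mem_quasiGenerated continuous_timesMap ⟨_, hJ.comp hφ, h1⟩
  have i2 := measurePreserving_of_mem_quasiGenerated continuous_timesMap ⟨_, hJ.comp hφ, h2⟩
  have i3 := measurePreserving_of_mem_quasiGenerated continuous_timesMap ⟨_, hJ.comp hφ, h3⟩
  refine ⟨φ, _, _, _, hφ, h1, h2, h3, ?_, ?_, ?_⟩
  · refine ksEntropy_map_le_add hr hadd.measurable hfst.measurable hsnd.measurable i3 i1 i2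
      (carry r) measurable_carry fun n p q h h' hc => ?_
    rw [digits_add_eq_carry, digits_add_eq_carry, h, h', hc]
  · refine ksEntropy_map_le_add hr hfst.measurable hadd.measurable hsnd.measurable i1 i3 i2
      (carry r) measurable_carry fun n p q h h' hc => ?_
    -- With the carry known, the addition formula can be solved for either summand in the group
    -- `ZMod (r ^ n)`.
    rw [digits_add_eq_carry, digits_add_eq_carry, h', hc] at h
    exact add_right_cancel (add_right_cancel h)
  · refine ksEntropy_map_le_add hr hsnd.measurable hadd.measurable hfst.measurable i2 i3 i1
      (carry r) measurable_carry fun n p q h h' hc => ?_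
    rw [digits_add_eq_carry, digits_add_eq_carry, h', hc] at h
    exact add_left_cancel (add_right_cancel h)

end Joining

/-! ### From measures to lower and upper entropies of points. -/

section Points

variable {r : ℕ}

theorem ksEntropy_mem_Icc_of_mem_quasiGenerated [NeZero r] (hr : 2 ≤ r) {x : UnitAddCircle}
    {μ : ProbabilityMeasure UnitAddCircle} (hμ : μ ∈ quasiGenerated (timesMap r) x) :
    ksEntropy (timesMap r) (μ : Measure UnitAddCircle) ∈
      Set.Icc 0 ((Real.logb 2 r : ℝ) : EReal) :=
  ksEntropy_mem_Icc hr (measurePreserving_of_mem_quasiGenerated continuous_timesMap hμ)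

theorem quasiGenerated_nonempty (x : UnitAddCircle) : (quasiGenerated (timesMap r) x).Nonempty := by
  obtain ⟨φ, μ, hφ, hμ⟩ := exists_tendsto_empiricalMeasure (timesMap r) x strictMono_id
  exact ⟨μ, φ, hφ, hμ⟩

theorem lowerEntropy_mem_Icc [NeZero r] (hr : 2 ≤ r) (x : UnitAddCircle) :
    lowerEntropy (timesMap r) x ∈ Set.Icc 0 ((Real.logb 2 r : ℝ) : EReal) := by
  obtain ⟨μ, hμ⟩ := quasiGenerated_nonempty (r := r) x
  exact ⟨le_iInf₂ fun ν hν => (ksEntropy_mem_Icc_of_mem_quasiGenerated hr hν).1,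
    iInf₂_le_of_le μ hμ (ksEntropy_mem_Icc_of_mem_quasiGenerated hr hμ).2⟩

theorem upperEntropy_mem_Icc [NeZero r] (hr : 2 ≤ r) (x : UnitAddCircle) :
    upperEntropy (timesMap r) x ∈ Set.Icc 0 ((Real.logb 2 r : ℝ) : EReal) := by
  obtain ⟨μ, hμ⟩ := quasiGenerated_nonempty (r := r) x
  exact ⟨le_iSup₂_of_le μ hμ (ksEntropy_mem_Icc_of_mem_quasiGenerated hr hμ).1,
    iSup₂_le fun ν hν => (ksEntropy_mem_Icc_of_mem_quasiGenerated hr hν).2⟩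

/-- Every sequence of times has a subsequence along which `a`, `b` and `c` quasi-generate measures,
the entropy of the first being at most the sum of the entropies of the other two. -/
def JointlySubadditive (r : ℕ) (a b c : UnitAddCircle) : Prop :=
  ∀ J : ℕ → ℕ, StrictMono J → ∃ (φ : ℕ → ℕ) (μ ν ξ : ProbabilityMeasure UnitAddCircle),
    StrictMono φ ∧
    Tendsto (fun k => empiricalMeasure (timesMap r) a (J (φ k))) atTop (𝓝 μ.toFiniteMeasure) ∧
    Tendsto (fun k => empiricalMeasure (timesMap r) b (J (φ k))) atTop (𝓝 ν.toFiniteMeasure) ∧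
    Tendsto (fun k => empiricalMeasure (timesMap r) c (J (φ k))) atTop (𝓝 ξ.toFiniteMeasure) ∧
    ksEntropy (timesMap r) (μ : Measure UnitAddCircle) ≤
      ksEntropy (timesMap r) (ν : Measure UnitAddCircle) +
        ksEntropy (timesMap r) (ξ : Measure UnitAddCircle)

variable {a b c : UnitAddCircle}

theorem JointlySubadditive.swap (h : JointlySubadditive r a b c) : JointlySubadditive r a c b := by
  intro J hJ
  obtain ⟨φ, μ, ν, ξ, hφ, hμ, hν, hξ, hle⟩ := h J hJ
  exact ⟨φ, μ, ξ, ν, hφ, hμ, hξ, hν, by rwa [add_comm]⟩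

/-- Start from times along which `a` generates a given measure; the subsequence keeps that limit. -/
theorem JointlySubadditive.upperEntropy_le (h : JointlySubadditive r a b c) :
    upperEntropy (timesMap r) a ≤ upperEntropy (timesMap r) b + upperEntropy (timesMap r) c := by
  refine iSup₂_le fun μ ⟨J, hJ, hlim⟩ => ?_
  obtain ⟨φ, μ', ν, ξ, hφ, hμ, hν, hξ, hle⟩ := h J hJ
  have hμμ' : μ = μ' := by
    have := tendsto_nhds_unique (hlim.comp hφ.tendsto_atTop) hμ
    exact (ProbabilityMeasure.toFiniteMeasure_isEmbedding _).injective this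
  subst hμμ'
  exact hle.trans (add_le_add (le_iSup₂_of_le ν ⟨_, hJ.comp hφ, hν⟩ le_rfl)
    (le_iSup₂_of_le ξ ⟨_, hJ.comp hφ, hξ⟩ le_rfl))

theorem JointlySubadditive.lowerEntropy_le [NeZero r] (hr : 2 ≤ r)
    (h : JointlySubadditive r a b c) :
    lowerEntropy (timesMap r) a ≤ lowerEntropy (timesMap r) b + upperEntropy (timesMap r) c := by
  obtain ⟨h0, h1⟩ := upperEntropy_mem_Icc hr c
  have hbot : upperEntropy (timesMap r) c ≠ ⊥ := (EReal.bot_lt_zero.trans_le h0).ne'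
  have htop : upperEntropy (timesMap r) c ≠ ⊤ := (h1.trans_lt (EReal.coe_lt_top _)).ne
  -- With the upper entropy of `c` moved to the left, the claim is a lower bound for an infimum over
  -- the measures of `b`, so the times are chosen to generate one of those.
  rw [← EReal.sub_le_iff_le_add (Or.inl hbot) (Or.inl htop)]
  refine le_iInf₂ fun ν ⟨J, hJ, hlim⟩ => ?_
  rw [EReal.sub_le_iff_le_add (Or.inl hbot) (Or.inl htop)]
  obtain ⟨φ, μ, ν', ξ, hφ, hμ, hν, hξ, hle⟩ := h J hJ
  have hνν' : ν = ν' := by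
    have := tendsto_nhds_unique (hlim.comp hφ.tendsto_atTop) hν
    exact (ProbabilityMeasure.toFiniteMeasure_isEmbedding _).injective this
  subst hνν'
  exact (iInf₂_le μ ⟨_, hJ.comp hφ, hμ⟩).trans
    (hle.trans (add_le_add le_rfl (le_iSup₂_of_le ξ ⟨_, hJ.comp hφ, hξ⟩ le_rfl)))

theorem jointlySubadditive_add [NeZero r] (hr : 2 ≤ r) (x y : UnitAddCircle) :
    JointlySubadditive r (x + y) x y ∧ JointlySubadditive r x (x + y) y ∧
      JointlySubadditive r y (x + y) x := by
  refine ⟨fun J hJ => ?_, fun J hJ => ?_, fun J hJ => ?_⟩ <;>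
    obtain ⟨φ, μ, ν, ξ, hφ, hμ, hν, hξ, h1, h2, h3⟩ := exists_joint_limits hr x y hJ
  · exact ⟨φ, ξ, μ, ν, hφ, hξ, hμ, hν, h1⟩
  · exact ⟨φ, μ, ξ, ν, hφ, hμ, hξ, hν, h2⟩
  · exact ⟨φ, ν, ξ, μ, hφ, hν, hξ, hμ, h3⟩

theorem exists_coe_eq_of_mem_Icc {z : EReal} {M : ℝ} (hz : z ∈ Set.Icc 0 (M : EReal)) :
    ∃ t : ℝ, (t : EReal) = z :=
  ⟨z.toReal, EReal.coe_toReal (hz.2.trans_lt (EReal.coe_lt_top _)).ne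
    (EReal.bot_lt_zero.trans_le hz.1).ne'⟩

end Points

end PointEntropy

/-! ### The main theorem. -/

theorem mainTheorem2 (r : ℕ) (hr : 2 ≤ r) :
    PointEntropy.topologicalEntropy (PointEntropy.timesMap r) = ((Real.logb 2 r : ℝ) : EReal) ∧
    ∀ x y : UnitAddCircle,
      let hlow : UnitAddCircle → EReal := PointEntropy.lowerEntropy (PointEntropy.timesMap r)
      let hupp : UnitAddCircle → EReal := PointEntropy.upperEntropy (PointEntropy.timesMap r)
      max 0 (max (hlow x - hupp y) (hlow y - hupp x)) ≤ hlow (x + y) ∧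
      hlow (x + y) ≤
        min ((Real.logb 2 r : ℝ) : EReal) (min (hlow x + hupp y) (hupp x + hlow y)) ∧
      max ((hlow x - hlow y).abs : EReal) ((hupp x - hupp y).abs : EReal) ≤ hupp (x + y) ∧
      hupp (x + y) ≤ min ((Real.logb 2 r : ℝ) : EReal) (hupp x + hupp y) := by
  have : NeZero r := ⟨by omega⟩
  refine ⟨PointEntropy.topologicalEntropy_timesMap hr, fun x y => ?_⟩
  intro hlow hupp
  obtain ⟨hz, hx, hy⟩ := PointEntropy.jointlySubadditive_add hr x y
  have hlow_mem : ∀ t, hlow t ∈ _ := PointEntropy.lowerEntropy_mem_Icc hr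
  have hupp_mem : ∀ t, hupp t ∈ _ := PointEntropy.upperEntropy_mem_Icc hr
  have l1 : hlow (x + y) ≤ hlow x + hupp y := hz.lowerEntropy_le hr
  have l2 : hlow (x + y) ≤ hlow y + hupp x := hz.swap.lowerEntropy_le hr
  have l3 : hlow x ≤ hlow (x + y) + hupp y := hx.lowerEntropy_le hr
  have l4 : hlow y ≤ hlow (x + y) + hupp x := hy.lowerEntropy_le hr
  have l5 : hlow x ≤ hlow y + hupp (x + y) := hx.swap.lowerEntropy_le hr
  have l6 : hlow y ≤ hlow x + hupp (x + y) := hy.swap.lowerEntropy_le hr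
  have u1 : hupp (x + y) ≤ hupp x + hupp y := hz.upperEntropy_le
  have u2 : hupp x ≤ hupp (x + y) + hupp y := hx.upperEntropy_le
  have u3 : hupp y ≤ hupp (x + y) + hupp x := hy.upperEntropy_le
  obtain ⟨z0, z1⟩ := hlow_mem (x + y)
  obtain ⟨-, w1⟩ := hupp_mem (x + y)
  obtain ⟨lx, hlx⟩ := PointEntropy.exists_coe_eq_of_mem_Icc (hlow_mem x)
  obtain ⟨ly, hly⟩ := PointEntropy.exists_coe_eq_of_mem_Icc (hlow_mem y)
  obtain ⟨lz, hlz⟩ := PointEntropy.exists_coe_eq_of_mem_Icc (hlow_mem (x + y))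
  obtain ⟨ux, hux⟩ := PointEntropy.exists_coe_eq_of_mem_Icc (hupp_mem x)
  obtain ⟨uy, huy⟩ := PointEntropy.exists_coe_eq_of_mem_Icc (hupp_mem y)
  obtain ⟨uz, huz⟩ := PointEntropy.exists_coe_eq_of_mem_Icc (hupp_mem (x + y))
  rw [← hlz] at z0 z1
  rw [← huz] at w1
  -- All six entropies are finite, so each claim becomes a linear inequality between reals.
  simp only [← hlx, ← hly, ← hlz, ← hux, ← huy, ← huz, ← EReal.coe_sub, ← EReal.coe_add,
    EReal.coe_abs, max_le_iff, le_min_iff, EReal.coe_le_coe_iff, abs_le] at *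
  refine ⟨⟨z0, ?_, ?_⟩, ⟨z1, ?_, ?_⟩, ⟨⟨?_, ?_⟩, ?_, ?_⟩, w1, ?_⟩ <;> linarith
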